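/- Let $\mathbb{k}$ be a field, let $0<a_1<a_2$ be integers with $\gcd(a_1,a_2)=1$, let $$S_{\mathbf a}=\langle (0,a_2),\,(a_1,a_2-a_1),\,(a_2,0)\rangle\subseteq\mathbb{N}^2$$ be the semigroup (with $0$) of the plane projective monomial curve defined by $\mathbf a=a_1,a_2$, let $R=\mathbb{k}[S_{\mathbf a}]$ be its semigroup ring, and let $\mathfrak m$ be the maximal graded ideal of $R$, generated by the monomials $\mathbf{x}^{s}$ with $0\ne s\in S_{\mathbf a}$. When $R$ is Cohen–Macaulay, let $\omega_R$ be its canonical module, that is, $\omega_R\cong\operatorname{Ext}^{\,n-d}_A(R,A)$ (up to a shift of degrees) for a polynomial ring $A=\mathbb{k}[x_1,\dots,x_n]$ mapping onto $R$, where $d=\dim R$. Let $\operatorname{tr}(\omega_R)$ be the ideal of $R$ generated by the images of all $R$-linear maps $\omega_R\to R$. Then the following conditions are equivalent: 1. $S_{\mathbf a}$ is Gorenstein, i.e. $R$ is Cohen–Macaulay and $\omega_R\cong R$ (up to a shift of degrees); 2. $S_{\mathbf a}$ is nearly Gorenstein, i.e. $R$ is Cohen–Macaulay and $\mathfrak m\subseteq\operatorname{tr}(\omega_R)$.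 -/

import Mathlib

open CategoryTheory

universe u

/-- The exponent semigroup `S_a` of the projective monomial curve defined by a sequence
`a = a_1, ..., a_n` (here `n = m + 1`): the submonoid of `ℕ × ℕ` generated by `(0, a_n)` and
`(a_i, a_n - a_i)` for `1 ≤ i ≤ n`. For `i = n` the last generator is `(a_n, 0)`. -/
def projectiveMonomialCurve {m : ℕ} (a : Fin (m + 1) → ℕ) : AddSubmonoid (ℕ × ℕ) :=
  AddSubmonoid.closure
    (insert (0, a (Fin.last m)) (Set.range fun i => (a i, a (Fin.last m) - a i)))

/-- The maximal graded ideal of the semigroup ring `k[S]`, for a submonoid `S` of `ℕ × ℕ`: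
the ideal generated by the monomials `x ^ s` with `s ∈ S` and `s ≠ 0`. -/
noncomputable def maximalGradedIdeal (k : Type u) [Field k] (S : AddSubmonoid (ℕ × ℕ)) :
    Ideal (AddMonoidAlgebra k S) :=
  Ideal.span {x | ∃ s : S, s ≠ 0 ∧ x = AddMonoidAlgebra.single s 1}

/-- `depth = dim` for `k[S]`: the maximal graded ideal contains a regular sequence
whose length is the Krull dimension of `k[S]`. -/
def IsCohenMacaulaySemigroup (k : Type u) [Field k] (S : AddSubmonoid (ℕ × ℕ)) : Prop :=
  ∃ rs : List (AddMonoidAlgebra k S),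
    (∀ r ∈ rs, r ∈ maximalGradedIdeal k S) ∧
    RingTheory.Sequence.IsRegular (AddMonoidAlgebra k S) rs ∧
    ringKrullDim (AddMonoidAlgebra k S) = rs.length

/-- `ω` is (up to isomorphism) the canonical module of the finitely generated `k`-algebra `R`:
for a presentation `π : A = k[x_1, ..., x_n] → R`, with `π` surjective, and `d = dim R`,
the module `ω` is isomorphic to `Ext_A^(n - d) (R, A)`.
(As `A` acts on both sides, and `π` is surjective, an `A`-linear isomorphism is the same as an
`R`-linear one. The choice of the presentation does not matter.) -/
def IsCanonicalModule (k R ω : Type u) [Field k] [CommRing R] [Algebra k R]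
    [AddCommGroup ω] [Module R ω] : Prop :=
  ∃ (n d i : ℕ) (π : MvPolynomial (Fin n) k →ₐ[k] R),
    Function.Surjective π ∧ ringKrullDim R = d ∧ d + i = n ∧
    Nonempty ((ModuleCat.restrictScalars (π : MvPolynomial (Fin n) k →+* R)).obj (ModuleCat.of R ω)
      ≃ₗ[MvPolynomial (Fin n) k]
      Abelian.Ext
        ((ModuleCat.restrictScalars (π : MvPolynomial (Fin n) k →+* R)).obj (ModuleCat.of R R))
        (ModuleCat.of (MvPolynomial (Fin n) k) (MvPolynomial (Fin n) k)) i)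

/-- The trace ideal `tr(M)`: the ideal generated by the images of all `R`-linear maps `M → R`. -/
def moduleTraceIdeal (R M : Type u) [CommRing R] [AddCommGroup M] [Module R M] : Ideal R :=
  ⨆ φ : M →ₗ[R] R, LinearMap.range φ

/-- `k[S]` is Gorenstein: it is Cohen-Macaulay, and isomorphic to its canonical module. -/
def IsGorensteinSemigroup (k : Type u) [Field k] (S : AddSubmonoid (ℕ × ℕ)) : Prop :=
  IsCohenMacaulaySemigroup k S ∧
    IsCanonicalModule k (AddMonoidAlgebra k S) (AddMonoidAlgebra k S)

/-- `k[S]` is nearly Gorenstein: it is Cohen-Macaulay, and the trace ideal of its canonical module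
contains the maximal graded ideal. -/
def IsNearlyGorensteinSemigroup (k : Type u) [Field k] (S : AddSubmonoid (ℕ × ℕ)) : Prop :=
  IsCohenMacaulaySemigroup k S ∧
    ∃ (ω : Type u) (_ : AddCommGroup ω) (_ : Module (AddMonoidAlgebra k S) ω),
      IsCanonicalModule k (AddMonoidAlgebra k S) ω ∧
      maximalGradedIdeal k S ≤ moduleTraceIdeal (AddMonoidAlgebra k S) ω

/-! The curve is a plane curve, so `R` is a hypersurface: `R ≅ A/(f)` with `A = k[x,y,z]` and `f =
y^b - x^(b-a) z^a`. Dualizing the resolution `0 → A → A → R → 0` given by `f` yields `Ext¹(R, A) ≅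
A/(f) ≅ R`, so `R` is its own canonical module. Hence both conditions reduce to Cohen–Macaulayness,
the trace of `R` being all of `R`. The work lies in `ker_curvePresentation`, `ringKrullDim_curve`
(so that the relevant Ext degree is 3 - 2 = 1) and the Ext computation. -/

/-- If `p : A → M` is surjective with kernel generated by a nonzerodivisor `f`, then
`Ext¹(M, A)` is isomorphic to `M`. -/
theorem nonempty_linearEquiv_ext_one {A : Type u} [CommRing A] {f : A} (hf : f ∈ nonZeroDivisors A)
    (M : ModuleCat.{u} A) (p : A →ₗ[A] M) (hp : Function.Surjective p)
    (hker : LinearMap.ker p = Ideal.span {f}) :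
    Nonempty (M ≃ₗ[A] Abelian.Ext M (ModuleCat.of A A) 1) := by
  have hw : p ∘ₗ LinearMap.lsmul A A f = 0 := by
    ext
    have : f ∈ LinearMap.ker p := by
      rw [hker]; exact Ideal.mem_span_singleton_self f
    simpa using this
  let T : ShortComplex (ModuleCat.{u} A) :=
    ShortComplex.mk (X₁ := ModuleCat.of A A) (X₂ := ModuleCat.of A A) (X₃ := M)
      (ModuleCat.ofHom (LinearMap.lsmul A A f)) (ModuleCat.ofHom p)
      (by rw [← ModuleCat.ofHom_comp, hw]; rfl)
  have hTf : T.f = f • 𝟙 (ModuleCat.of A A) := by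
    ext
    simp [T]
  have hT : T.ShortExact :=
    { exact := by
        rw [ShortComplex.moduleCat_exact_iff]
        intro x hx
        have hx' : x ∈ LinearMap.ker p := hx
        rw [hker, Ideal.mem_span_singleton'] at hx'
        obtain ⟨a, ha⟩ := hx'
        exact ⟨a, (mul_comm f a).trans ha⟩
      mono_f := by
        rw [ModuleCat.mono_iff_injective]
        intro x y hxy
        exact (mul_cancel_left_mem_nonZeroDivisors hf).1 hxy
      epi_g := by
        rw [ModuleCat.epi_iff_surjective]
        exact hp }
  have : Projective T.X₂ := inferInstanceAs (Projective (ModuleCat.of A A))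
  let E := Abelian.Ext M (ModuleCat.of A A) 1
  let e : E := hT.extClass
  let q : A →ₗ[A] E := LinearMap.toSpanSingleton A E e
  -- Since `Ext¹(A, A) = 0`, every class comes from `Hom(A, A) = A` by the connecting map, so `e`
  -- generates.
  have hq : Function.Surjective q := by
    intro x
    obtain ⟨y, hy⟩ := Abelian.Ext.contravariant_sequence_exact₃ hT (ModuleCat.of A A) x
      (Abelian.Ext.eq_zero_of_projective _) (add_comm 1 0)
    obtain ⟨g, rfl⟩ := (Abelian.Ext.mk₀_bijective _ _).2 y
    refine ⟨g.hom (1 : A), ?_⟩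
    have hg : g = (g.hom (1 : A) : A) • 𝟙 (ModuleCat.of A A) := by
      ext
      change g.hom (1 : A) = g.hom (1 : A) * (1 : A)
      rw [mul_one]
    rw [← hy]
    conv_rhs => rw [hg]
    rw [LinearMap.toSpanSingleton_apply, Abelian.Ext.smul_eq_comp_mk₀]
  have hqker : LinearMap.ker q = Ideal.span {f} := by
    ext a
    rw [LinearMap.mem_ker, LinearMap.toSpanSingleton_apply, Ideal.mem_span_singleton',
      Abelian.Ext.smul_eq_comp_mk₀]
    constructor
    -- By exactness, `a • e = 0` forces multiplication by `a` to factor through multiplication by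
    -- `f`.
    · intro h
      obtain ⟨y, hy⟩ := Abelian.Ext.contravariant_sequence_exact₁ hT (ModuleCat.of A A)
        (Abelian.Ext.mk₀ (a • 𝟙 (ModuleCat.of A A))) (add_comm 1 0) h
      obtain ⟨g, rfl⟩ := (Abelian.Ext.mk₀_bijective _ _).2 y
      rw [Abelian.Ext.mk₀_comp_mk₀] at hy
      have hy' := (Abelian.Ext.mk₀_bijective _ _).1 hy
      rw [hTf] at hy'
      have := congrArg (fun h : ModuleCat.of A A ⟶ ModuleCat.of A A => (h.hom (1 : A) : A)) hy'
      refine ⟨g.hom (1 : A), ?_⟩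
      simpa [mul_comm] using this
    · rintro ⟨b, rfl⟩
      have h0 : Abelian.Ext.mk₀ ((b * f) • 𝟙 (ModuleCat.of A A)) =
          (Abelian.Ext.mk₀ T.f).comp (Abelian.Ext.mk₀ (b • 𝟙 (ModuleCat.of A A)))
            (zero_add 0) := by
        rw [Abelian.Ext.mk₀_comp_mk₀, hTf]
        congr 1
        ext
        change b * f * (1 : A) = b * (f * (1 : A))
        rw [mul_assoc]
      rw [h0]
      exact hT.extClass_comp_assoc _
  exact ⟨(LinearMap.quotKerEquivOfSurjective p hp).symm ≪≫ₗ
    Submodule.quotEquivOfEq _ _ (hker.trans hqker.symm) ≪≫ₗ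
    LinearMap.quotKerEquivOfSurjective q hq⟩

theorem moduleTraceIdeal_self (R : Type u) [CommRing R] : moduleTraceIdeal R R = ⊤ := by
  refine top_le_iff.1 (le_iSup_of_le LinearMap.id ?_)
  rw [LinearMap.range_id]

theorem isDomain_addMonoidAlgebra_submonoid (k : Type u) [Field k] (S : AddSubmonoid (ℕ × ℕ)) :
    IsDomain (AddMonoidAlgebra k S) :=
  have : TwoUniqueSums S :=
    TwoUniqueSums.of_injective_addHom S.subtype.toAddHom Subtype.val_injective inferInstance
  inferInstance

/-! ### The semigroup ring as a hypersurface of dimension two -/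

section Hypersurface

variable (k : Type u) [Field k] (a b : ℕ)

/-- The binomial `y ^ b - x ^ (b - a) * z ^ a`. -/
noncomputable def curveBinomial : MvPolynomial (Fin 3) k :=
  .X 1 ^ b - .X 0 ^ (b - a) * .X 2 ^ a

theorem curveBinomial_ne_zero (ha : 0 < a) : curveBinomial k a b ≠ 0 := by
  intro h
  have := congrArg (MvPolynomial.aeval ![(1 : k), 1, 0]) h
  simp [curveBinomial, ha.ne'] at this

/-- Division by `f` with leading term `y^b`: each rewriting of `y^b` as `x^(b-a) z^a` lowers the
`y`-exponent by `b`. -/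
theorem exists_reduced_sub_mem_span (hb : 0 < b) (p : MvPolynomial (Fin 3) k) :
    ∃ r ∈ MvPolynomial.restrictSupport k {m : Fin 3 →₀ ℕ | m 1 < b},
      p - r ∈ Ideal.span {curveBinomial k a b} := by
  have key : ∀ (n : ℕ) (m : Fin 3 →₀ ℕ) (c : k), m 1 = n →
      ∃ r ∈ MvPolynomial.restrictSupport k {m : Fin 3 →₀ ℕ | m 1 < b},
        MvPolynomial.monomial m c - r ∈ Ideal.span {curveBinomial k a b} := by
    intro n
    induction n using Nat.strong_induction_on with
    | _ n ih =>
    intro m c hm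
    by_cases hlt : m 1 < b
    · refine ⟨MvPolynomial.monomial m c, ?_, by simp⟩
      rw [MvPolynomial.mem_restrictSupport_iff]
      intro x hx
      have := MvPolynomial.support_monomial_subset hx
      simp only [Finset.mem_singleton] at this
      simpa [this] using hlt
    · push Not at hlt
      let m' : Fin 3 →₀ ℕ := m - Finsupp.single 1 b
      have hm' : m' + Finsupp.single 1 b = m := by
        ext i
        by_cases hi : i = 1
        · subst hi; simp [m']; omega
        · simp [m', Ne.symm hi]
      let m'' : Fin 3 →₀ ℕ := m' + (Finsupp.single 0 (b - a) + Finsupp.single 2 a)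
      obtain ⟨r, hr, hmem⟩ := ih (m'' 1) (by simp [m'', m']; omega) m'' c rfl
      refine ⟨r, hr, ?_⟩
      have : MvPolynomial.monomial m c - MvPolynomial.monomial m'' c =
          MvPolynomial.monomial m' c * curveBinomial k a b := by
        simp only [curveBinomial, MvPolynomial.X_pow_eq_monomial, mul_sub,
          MvPolynomial.monomial_mul, mul_one, hm', m'']
      rw [← sub_add_sub_cancel _ (MvPolynomial.monomial m'' c) r]
      refine Ideal.add_mem _ ?_ hmem
      rw [this]
      exact Ideal.mul_mem_left _ _ (Ideal.mem_span_singleton_self _)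
  induction p using MvPolynomial.induction_on' with
  | monomial m c => exact key _ m c rfl
  | add p q hp hq =>
    obtain ⟨r, hr, h⟩ := hp
    obtain ⟨s, hs, h'⟩ := hq
    exact ⟨r + s, Submodule.add_mem _ hr hs, by
      rw [add_sub_add_comm]; exact Ideal.add_mem _ h h'⟩

variable {a b}

/-- The three generators of the exponent semigroup of the plane curve. -/
def curveGenerator (a b : ℕ) : Fin 3 → projectiveMonomialCurve ![a, b] :=
  ![⟨(0, b), AddSubmonoid.subset_closure (Or.inl rfl)⟩,
    ⟨(a, b - a), AddSubmonoid.subset_closure (Or.inr ⟨0, rfl⟩)⟩,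
    ⟨(b, 0), AddSubmonoid.subset_closure (Or.inr ⟨1, by simp⟩)⟩]

/-- The exponent of the image of a monomial in `k[S]`. -/
def curveExponent (a b : ℕ) : (Fin 3 →₀ ℕ) →+ projectiveMonomialCurve ![a, b] where
  toFun m := m 0 • curveGenerator a b 0 + m 1 • curveGenerator a b 1 + m 2 • curveGenerator a b 2
  map_zero' := by simp
  map_add' m n := by simp only [Finsupp.add_apply, add_smul]; abel

theorem coe_curveExponent (m : Fin 3 →₀ ℕ) : (curveExponent a b m : ℕ × ℕ) =
    (m 1 * a + m 2 * b, m 0 * b + m 1 * (b - a)) := by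
  simp [curveExponent, curveGenerator]

theorem curveExponent_surjective : Function.Surjective (curveExponent a b) := by
  rintro ⟨s, hs⟩
  suffices h : s ∈ AddMonoidHom.mrange
      ((projectiveMonomialCurve ![a, b]).subtype.comp (curveExponent a b)) by
    obtain ⟨m, hm⟩ := h
    exact ⟨m, Subtype.ext hm⟩
  refine (AddSubmonoid.closure_le (S := AddMonoidHom.mrange _)).2 ?_ hs
  rintro x (rfl | ⟨i, rfl⟩)
  · exact ⟨Finsupp.single 0 1, by simp [coe_curveExponent]⟩
  · fin_cases i
    · exact ⟨Finsupp.single 1 1, by simp [coe_curveExponent]⟩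
    · exact ⟨Finsupp.single 2 1, by simp [coe_curveExponent]⟩

/-- The first coordinate modulo `b` determines the `y`-exponent, as `a` is invertible modulo `b`;
the other two exponents follow. -/
theorem curveExponent_injOn (hab : a < b) (hgcd : Nat.gcd a b = 1) :
    Set.InjOn (curveExponent a b) {m | m 1 < b} := by
  intro m hm n hn h
  have h' := congrArg (Subtype.val) h
  rw [coe_curveExponent, coe_curveExponent, Prod.mk.injEq] at h'
  obtain ⟨h1, h2⟩ := h'
  have hb : 0 < b := by omega
  have hm1 : m 1 = n 1 := by
    have hmod : m 1 * a ≡ n 1 * a [MOD b] := by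
      have : (m 1 * a + m 2 * b) % b = (n 1 * a + n 2 * b) % b := by rw [h1]
      simpa [Nat.ModEq, Nat.add_mul_mod_self_right] using this
    have := Nat.ModEq.cancel_right_of_coprime (by rwa [Nat.gcd_comm] at hgcd) hmod
    exact Nat.ModEq.eq_of_lt_of_lt this hm hn
  rw [hm1] at h1 h2
  have hm2 : m 2 = n 2 := Nat.eq_of_mul_eq_mul_right hb (by omega)
  have hm0 : m 0 = n 0 := Nat.eq_of_mul_eq_mul_right hb (by omega)
  ext i
  fin_cases i <;> assumption

/-- The presentation of the semigroup ring of the plane curve by three variables. -/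
noncomputable def curvePresentation (a b : ℕ) :
    MvPolynomial (Fin 3) k →ₐ[k] AddMonoidAlgebra k (projectiveMonomialCurve ![a, b]) :=
  AddMonoidAlgebra.mapDomainAlgHom k k (curveExponent a b)

theorem curvePresentation_monomial (m : Fin 3 →₀ ℕ) (c : k) :
    curvePresentation k a b (MvPolynomial.monomial m c) =
      AddMonoidAlgebra.single (curveExponent a b m) c :=
  AddMonoidAlgebra.mapDomain_single

theorem curvePresentation_surjective : Function.Surjective (curvePresentation k a b) := by
  intro x
  change x ∈ (curvePresentation k a b).range
  induction x using AddMonoidAlgebra.induction_linear with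
  | zero => exact zero_mem _
  | add x y hx hy => exact add_mem hx hy
  | single s c =>
    obtain ⟨m, rfl⟩ := curveExponent_surjective s
    exact ⟨MvPolynomial.monomial m c, curvePresentation_monomial k m c⟩

theorem curvePresentation_curveBinomial :
    curvePresentation k a b (curveBinomial k a b) = 0 := by
  simp only [curveBinomial, MvPolynomial.X_pow_eq_monomial, MvPolynomial.monomial_mul, mul_one,
    map_sub, curvePresentation_monomial]
  rw [sub_eq_zero]
  congr 1
  apply Subtype.ext
  simp [coe_curveExponent, mul_comm]

theorem eq_zero_of_curvePresentation_eq_zero (hab : a < b) (hgcd : Nat.gcd a b = 1)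
    {r : MvPolynomial (Fin 3) k}
    (hr : r ∈ MvPolynomial.restrictSupport k {m : Fin 3 →₀ ℕ | m 1 < b})
    (h : curvePresentation k a b r = 0) : r = 0 := by
  rw [MvPolynomial.mem_restrictSupport_iff] at hr
  have h' : Finsupp.mapDomain (curveExponent a b) (AddMonoidAlgebra.coeff r) = 0 :=
    congrArg AddMonoidAlgebra.coeff h
  apply AddMonoidAlgebra.coeff_injective
  exact Finsupp.mapDomain_injOn _ (curveExponent_injOn hab hgcd) hr (by simp) (by simpa using h')

/-- A kernel element has its remainder modulo `f` in the kernel too; the monomials of that remainder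
have distinct images, so it vanishes. -/
theorem ker_curvePresentation (ha : 0 < a) (hab : a < b) (hgcd : Nat.gcd a b = 1) :
    RingHom.ker (curvePresentation k a b) = Ideal.span {curveBinomial k a b} := by
  have hle : Ideal.span {curveBinomial k a b} ≤ RingHom.ker (curvePresentation k a b) :=
    (Ideal.span_singleton_le_iff_mem _).2 (curvePresentation_curveBinomial k)
  refine le_antisymm (fun p hp => ?_) hle
  obtain ⟨r, hr, hmem⟩ := exists_reduced_sub_mem_span k a b (ha.trans hab) p
  have hr0 : curvePresentation k a b r = 0 := by
    have := hle hmem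
    rwa [RingHom.mem_ker, map_sub, (RingHom.mem_ker).1 hp, zero_sub, neg_eq_zero] at this
  rwa [eq_zero_of_curvePresentation_eq_zero k hab hgcd hr hr0, sub_zero] at hmem

theorem ringKrullDim_curve (ha : 0 < a) (hab : a < b) (hgcd : Nat.gcd a b = 1) :
    ringKrullDim (AddMonoidAlgebra k (projectiveMonomialCurve ![a, b])) = (2 : ℕ) := by
  have := isDomain_addMonoidAlgebra_submonoid k (projectiveMonomialCurve ![a, b])
  apply le_antisymm
  · have h := ringKrullDim_succ_le_of_surjective
      (curvePresentation k a b).toRingHom (curvePresentation_surjective k)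
      (mem_nonZeroDivisors_of_ne_zero (curveBinomial_ne_zero k a b ha))
      (curvePresentation_curveBinomial k)
    rw [MvPolynomial.ringKrullDim_of_isNoetherianRing, ringKrullDim_eq_zero_of_field, zero_add,
      Nat.card_fin] at h
    have h3 : ((3 : ℕ) : WithBot ℕ∞) = (2 : ℕ) + 1 := by norm_num
    rw [h3] at h
    exact ENat.WithBot.add_le_add_one_right_iff.1 h
  -- Setting `x = y = 0` kills both terms of `f`, so `R` maps onto `k[z]`, of dimension one. The
  -- kernel contains the image of `x`, nonzero in a domain, so `dim R ≥ 2`.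
  · let ψ : MvPolynomial (Fin 3) k →+* Polynomial k :=
      (MvPolynomial.aeval ![(0 : Polynomial k), 0, Polynomial.X]).toRingHom
    have hψ : RingHom.ker (curvePresentation k a b).toRingHom ≤
        RingHom.ker ψ := by
      change RingHom.ker (curvePresentation k a b) ≤ _
      rw [ker_curvePresentation k ha hab hgcd, Ideal.span_singleton_le_iff_mem, RingHom.mem_ker]
      simp [ψ, curveBinomial, (ha.trans hab).ne', Nat.sub_ne_zero_of_lt hab]
    let g := RingHom.liftOfSurjective (curvePresentation k a b).toRingHom
      (curvePresentation_surjective k) ⟨ψ, hψ⟩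
    have hg : ∀ p, g (curvePresentation k a b p) = ψ p := fun p =>
      RingHom.liftOfRightInverse_comp_apply _ _ _ ⟨ψ, hψ⟩ p
    have hgs : Function.Surjective g := by
      intro q
      refine ⟨curvePresentation k a b (Polynomial.aeval (MvPolynomial.X 2) q), ?_⟩
      rw [hg]
      induction q using Polynomial.induction_on' with
      | add p q hp hq => simp only [map_add, hp, hq]
      | monomial n c => simp [ψ, Polynomial.aeval_monomial, Polynomial.C_mul_X_pow_eq_monomial]
    have h := ringKrullDim_succ_le_of_surjective g hgs
      (r := curvePresentation k a b (MvPolynomial.X 0))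
      (mem_nonZeroDivisors_of_ne_zero (by
        rw [MvPolynomial.X, curvePresentation_monomial]
        simp))
      (by rw [hg]; simp [ψ])
    rw [IsPrincipalIdealRing.ringKrullDim_eq_one (Polynomial k) (Polynomial.not_isField k)] at h
    have h2 : ((2 : ℕ) : WithBot ℕ∞) = 1 + 1 := by norm_num
    rwa [h2]

end Hypersurface


theorem isCanonicalModule_curve (k : Type u) [Field k] {a b : ℕ} (ha : 0 < a) (hab : a < b)
    (hgcd : Nat.gcd a b = 1) :
    IsCanonicalModule k (AddMonoidAlgebra k (projectiveMonomialCurve ![a, b]))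
      (AddMonoidAlgebra k (projectiveMonomialCurve ![a, b])) := by
  refine ⟨3, 2, 1, curvePresentation k a b, curvePresentation_surjective k,
    ringKrullDim_curve k ha hab hgcd, rfl, ?_⟩
  let M := (ModuleCat.restrictScalars
    (curvePresentation k a b).toRingHom).obj (ModuleCat.of _
      (AddMonoidAlgebra k (projectiveMonomialCurve ![a, b])))
  let p : MvPolynomial (Fin 3) k →ₗ[MvPolynomial (Fin 3) k] M :=
    { toFun := curvePresentation k a b
      map_add' := map_add (curvePresentation k a b)
      map_smul' := map_mul (curvePresentation k a b) }
  refine nonempty_linearEquiv_ext_one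
    (mem_nonZeroDivisors_of_ne_zero (curveBinomial_ne_zero k a b ha)) M p
    (curvePresentation_surjective k) ?_
  rw [← ker_curvePresentation k ha hab hgcd]
  rfl

theorem proposition4p1 (k : Type u) [Field k] (a₁ a₂ : ℕ) (h₀ : 0 < a₁) (h₁ : a₁ < a₂)
    (hgcd : Nat.gcd a₁ a₂ = 1) :
    IsGorensteinSemigroup k (projectiveMonomialCurve ![a₁, a₂]) ↔
      IsNearlyGorensteinSemigroup k (projectiveMonomialCurve ![a₁, a₂]) := by
  constructor
  · rintro ⟨hCM, hω⟩
    exact ⟨hCM, _, inferInstance, inferInstance, hω, by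
      rw [moduleTraceIdeal_self]; exact le_top⟩
  · rintro ⟨hCM, -⟩
    exact ⟨hCM, isCanonicalModule_curve k h₀ h₁ hgcd⟩
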